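/- Let $n,K\ge 1$ be integers and $\gamma>0$. There are $n$ teachers; a database is a family $f=(f_1,\dots,f_n)$ of classifiers $f_i:\mathcal X\to[K]=\{1,\dots,K\}$, and two databases are adjacent if they differ by exactly one teacher, i.e. $f_{i_0}\ne f'_{i_0}$ for some $i_0$ and $f_i=f'_i$ for all $i\neq i_0$. On a query $x\in\mathcal X$, teacher $i$ sends the vector with $k$-th coordinate $\mathbf 1_{f_i(x)=k}+N^{(i)}_k$, where $N^{(i)}$ is its noise, and the aggregation mechanism outputs a $k\in[K]$ that maximises the noisy count $\sum_{i=1}^n(\mathbf 1_{f_i(x)=k}+N^{(i)}_k)$, ties being broken by any (measurable) rule. Let $H\subset[n]$ be the set of the teachers whose noise is unknown to an entity $\mathcal E$, and suppose that $\tau:=|H|/n\in(0,1)$. For $i\in H$ and $k\in[K]$, the $N^{(i)}_k$ are i.i.d. and distributed as $G_1-G_2$ with $G_1,G_2$ independent of Gamma distribution of shape $1/n$ and scale $1/\gamma$; the noises $(N^{(i)})_{i\notin H}$, known to $\mathcal E$, are independent of these and follow any joint law that does not depend on the database (for instance the same i.i.d. law, or no noise). From $\mathcal E$'s point of view, the output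 of the mechanism on $x$ is the pair formed by the known noises $(N^{(i)})_{i\notin H}$ and the label that is output. A mechanism $\mathcal M$ is $(\epsilon,\delta)$-differentially private if $\mathbb P[\mathcal M(f)\in S]\le e^{\epsilon}\,\mathbb P[\mathcal M(f')\in S]+\delta$ for all adjacent $f,f'$ and all measurable sets $S$ of outputs. For $v>0$ let $I(v)=\int_0^{\infty}(t+v)^{\tau-1}t^{\tau-1}e^{-2t}\,dt$, and for $t\in\mathbb R$ let $$g(t)=\frac{\int_{\gamma t}^{\infty}e^{-|v|}I(|v|)\,dv}{\int_{\gamma(t+2)}^{\infty}e^{-|v|}I(|v|)\,dv}.$$ These integrals converge, $\int_{2\gamma}^\infty e^{-v}I(v)\,dv>0$, and for every query, from $\mathcal E$'s point of view, the mechanism is $(\epsilon,0)$-differentially private with $$\epsilon=\log\left(1+2\,\frac{\int_0^{\gamma}e^{-v}I(v)\,dv}{\int_{2\gamma}^{\infty}e^{-v}I(v)\,dv}\right).$$ If moreover $\tau>\tfrac12$, then the integral defining $I$ also converges at $v=0$, $g$ is differentiable at $0$ with $$g'(0)=\gamma\,\frac{\frac{\Gamma(\tau)^2}{2}e^{-2\gamma}I(2\gamma)-I(0)\int_{2\gamma}^{\infty}e^{-v}I(v)\,dv}{\left(\int_{2\gamma}^{\infty}e^{-v}I(v)\,dv\right)^2},$$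 $g(0)-g'(0)>0$, and the mechanism is $(\epsilon',0)$-differentially private from $\mathcal E$'s point of view for every query, with $\epsilon'=\min\left[\epsilon,\ \log\left(g(0)-g'(0)\right)\right]$. -/

import Mathlib

open MeasureTheory ProbabilityTheory

namespace NoisyVote

noncomputable section

/-- `(ε, δ)`-differential privacy of a randomised mechanism `M` (each database is sent to the
law of the output) with respect to an adjacency relation on databases. -/
def IsDP {D R : Type*} [MeasurableSpace R] (adj : D → D → Prop) (M : D → Measure R)
    (ε δ : ℝ) : Prop :=
  (∀ d, IsProbabilityMeasure (M d)) ∧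
    ∀ d d', adj d d' → ∀ S, MeasurableSet S →
      (M d).real S ≤ Real.exp ε * (M d').real S + δ

/-- A database is a family of `n` teachers, teacher `i` being a classifier `X → [K]`. Two databases
are adjacent if they differ by exactly one teacher. -/
def Adjacent {n K : ℕ} {X : Type*} (f f' : Fin n → X → Fin K) : Prop :=
  ∃ i₀, f i₀ ≠ f' i₀ ∧ ∀ i, i ≠ i₀ → f i = f' i

/-- Law of `G₁ - G₂` for `G₁, G₂` independent with Gamma distribution of shape `1 / n` and scale
`1 / γ` (Mathlib's `gammaMeasure` takes the shape and the rate `γ`). -/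
def gammaDiff (n : ℕ) (γ : ℝ) : Measure ℝ :=
  ((gammaMeasure (1 / n) γ).prod (gammaMeasure (1 / n) γ)).map fun p => p.1 - p.2

/-- Joint law of the noise vectors of the teachers in `H`: all coordinates of all
these vectors are i.i.d. Gamma differences. -/
def hiddenNoise {n : ℕ} (K : ℕ) (H : Finset (Fin n)) (γ : ℝ) :
    Measure ({i // i ∈ H} → Fin K → ℝ) :=
  Measure.pi fun _ => Measure.pi fun _ => gammaDiff n γ

/-- The noise of all the teachers: `w` on `H` and `c` outside `H`. -/
def joinNoise {n K : ℕ} (H : Finset (Fin n)) (w : {i // i ∈ H} → Fin K → ℝ)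
    (c : {i // i ∉ H} → Fin K → ℝ) : Fin n → Fin K → ℝ :=
  fun i => if h : i ∈ H then w ⟨i, h⟩ else c ⟨i, h⟩

/-- The noisy count of class `k` on the query `x`: the sum over all the teachers of the one-hot
encoding of the vote plus the noise of the teacher. -/
def noisyCount {n K : ℕ} {X : Type*} (f : Fin n → X → Fin K) (x : X)
    (z : Fin n → Fin K → ℝ) (k : Fin K) : ℝ :=
  ∑ i, ((if f i x = k then 1 else 0) + z i k)

/-- `sel` returns an index of a largest coordinate; ties are broken by any measurable rule. -/
def IsArgmaxRule {K : ℕ} (sel : (Fin K → ℝ) → Fin K) : Prop :=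
  Measurable sel ∧ ∀ (y : Fin K → ℝ) (k : Fin K), y k ≤ y (sel y)

/-- What the entity sees when the query `x` is answered: the noise sent by the teachers outside
`H`, whose law is `ν`, and the argmax of the noisy counts. The noise of the teachers in `H` is
independent of it and is not seen. -/
def viewLaw {n K : ℕ} {X : Type*} (γ : ℝ) (H : Finset (Fin n)) (sel : (Fin K → ℝ) → Fin K)
    (ν : Measure ({i // i ∉ H} → Fin K → ℝ)) (x : X) (f : Fin n → X → Fin K) :
    Measure (({i // i ∉ H} → Fin K → ℝ) × Fin K) :=
  (ν.prod (hiddenNoise K H γ)).map fun p =>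
    (p.1, sel (noisyCount f x (joinNoise H p.2 p.1)))

/-- The integrand of `I`. -/
def integrandI (τ v t : ℝ) : ℝ := (t + v) ^ (τ - 1) * t ^ (τ - 1) * Real.exp (-2 * t)

/-- `I(v) = ∫_0^∞ (t + v)^(τ - 1) t^(τ - 1) e^(-2t) dt`. -/
def funI (τ v : ℝ) : ℝ := ∫ t in Set.Ioi (0 : ℝ), integrandI τ v t

/-- `T(s) = ∫_s^∞ e^(-|v|) I(|v|) dv`, for every real `s`. -/
def tail (τ s : ℝ) : ℝ := ∫ v in Set.Ioi s, Real.exp (-|v|) * funI τ |v|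

/-- `g(t) = T(γ t) / T(γ (t + 2))`, the ratio of the probabilities that a generalised Laplace
variable exceeds `t` and `t + 2`. -/
def funG (γ τ t : ℝ) : ℝ := tail τ (γ * t) / tail τ (γ * (t + 2))

/-- The privacy parameter `log (1 + 2 ∫_0^γ e^(-v) I(v) dv / ∫_{2γ}^∞ e^(-v) I(v) dv)`. -/
def epsGamma (γ τ : ℝ) : ℝ :=
  Real.log (1 + 2 * ((∫ v in (0 : ℝ)..γ, Real.exp (-v) * funI τ v) /
    ∫ v in Set.Ioi (2 * γ), Real.exp (-v) * funI τ v))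

/-- The explicit value of `g'(0)`. -/
def gPrimeZero (γ τ : ℝ) : ℝ :=
  γ * ((Real.Gamma τ ^ 2 / 2 * Real.exp (-2 * γ) * funI τ (2 * γ) -
      funI τ 0 * ∫ v in Set.Ioi (2 * γ), Real.exp (-v) * funI τ v) /
    (∫ v in Set.Ioi (2 * γ), Real.exp (-v) * funI τ v) ^ 2)

end

end NoisyVote

/-! Conditionally on the known noises, which only shift the counts, the hidden noise of each class
is a sum of |H| independent Gamma differences of shape 1/n, hence a Gamma difference of shape τ;
classes stay independent. Its density is proportional to e^(-|v|) I(|v|) at v = γs. Freeze the noise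
of all classes but k: label k wins when its own noise passes a threshold. Changing one teacher moves
every count by at most 1, so the threshold by at most 2. Privacy thus reduces to bounding T(s)/T(s +
2b) over all real s, where T is `tail` and b = γ (`isDP_viewLaw_of_tail_le`).

Three regimes. For s ≥ 0, Gamma densities of shape at most 1 are log-convex, Hölder passes this on
to T, and the ratio is at most its value at 0 (`tail_mul_tail_le`). For s ≤ -b, symmetry and
monotonicity of the kernel bound it by its value at -b (`tail_mul_tail_le_of_le_neg`). On [-b, 0],
the window [s, s + 2b] has at most the mass of [-b, b], and T(s + 2b) ≥ T(2b); this gives the first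
bound (`tail_le_mul_tail`).

If τ > 1/2 the kernel is finite and continuous at 0. Linear bounds on both tails then keep the ratio
on [-b, 0] below its tangent at 0 taken at s = -b, i.e. g(0) - g'(0) (`tail_le_tangent_mul_tail`).
-/

namespace NoisyVote

noncomputable section

/-! ### Gamma differences: moment generating functions and stability -/

/-- Two probability measures on the line with the same moment generating function, finite
around `0`, are equal. -/
lemma measure_eq_of_mgf_eq {μ ν : Measure ℝ} [IsProbabilityMeasure μ] [IsProbabilityMeasure ν]
    (h : mgf id μ = mgf id ν) (h0 : (0 : ℝ) ∈ interior (integrableExpSet id μ)) : μ = ν := by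
  refine Measure.ext_of_charFun (funext fun t => ?_)
  rw [← complexMGF_id_mul_I, ← complexMGF_id_mul_I]
  exact eqOn_complexMGF_of_mgf h (by simpa using h0)

/-- The value 0 for t ≥ r is that of a divergent Bochner integral. It is recorded because comparing
laws by `measure_eq_of_mgf_eq` needs equality at every t. -/
lemma mgf_gammaMeasure {a r : ℝ} (ha : 0 < a) (hr : 0 < r) (t : ℝ) :
    mgf id (gammaMeasure a r) t = if t < r then (r / (r - t)) ^ a else 0 := by
  have hΓ : Real.Gamma a ≠ 0 := (Real.Gamma_pos_of_pos ha).ne'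
  have h1 : ∀ x : ℝ, (gammaPDF a r x).toReal = gammaPDFReal a r x := fun x =>
    ENNReal.toReal_ofReal (gammaPDFReal_nonneg ha hr x)
  have h2 : mgf id (gammaMeasure a r) t =
      r ^ a / Real.Gamma a * ∫ x in Set.Ioi (0 : ℝ), x ^ (a - 1) * Real.exp (-((r - t) * x)) := by
    rw [mgf, gammaMeasure,
      integral_withDensity_eq_integral_toReal_smul (by unfold gammaPDF; fun_prop)
        (ae_of_all _ fun _ => by simp [gammaPDF])]
    simp_rw [h1]
    rw [← integral_Ici_eq_integral_Ioi, ← integral_const_mul,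
      ← integral_indicator measurableSet_Ici]
    congr 1
    ext x
    by_cases hx : 0 ≤ x
    · rw [Set.indicator_of_mem (Set.mem_Ici.2 hx), gammaPDFReal, if_pos hx, smul_eq_mul,
        mul_assoc, mul_assoc, ← Real.exp_add, id]
      ring_nf
    · rw [Set.indicator_of_notMem (by simpa using hx), gammaPDFReal, if_neg hx, zero_smul]
  rw [h2]
  split_ifs with ht
  · rw [Real.integral_rpow_mul_exp_neg_mul_Ioi ha (by linarith), Real.div_rpow hr.le (by linarith),
      Real.div_rpow zero_le_one (by linarith), Real.one_rpow]
    field_simp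
  · rw [integral_undef, mul_zero]
    intro hi
    refine not_integrableOn_Ioi_rpow (a - 1) (hi.mono' (by fun_prop) ?_)
    refine (ae_restrict_iff' measurableSet_Ioi).2 (ae_of_all _ fun x hx => ?_)
    have hx0 : (0 : ℝ) < x := hx
    rw [Real.norm_of_nonneg (by positivity)]
    refine le_mul_of_one_le_right (by positivity) (Real.one_le_exp ?_)
    nlinarith [not_lt.1 ht]

/-- Law of `G₁ - G₂` for independent Gamma variables of shape `a` and rate `r`. -/
def gammaDiffLaw (a r : ℝ) : Measure ℝ :=
  ((gammaMeasure a r).prod (gammaMeasure a r)).map fun p => p.1 - p.2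

lemma isProbabilityMeasure_gammaDiffLaw {a r : ℝ} (ha : 0 < a) (hr : 0 < r) :
    IsProbabilityMeasure (gammaDiffLaw a r) := by
  have := isProbabilityMeasure_gammaMeasure ha hr
  exact Measure.isProbabilityMeasure_map (by fun_prop)

lemma mgf_gammaDiffLaw {a r : ℝ} (ha : 0 < a) (hr : 0 < r) (t : ℝ) :
    mgf id (gammaDiffLaw a r) t =
      if |t| < r then (r ^ 2 / (r ^ 2 - t ^ 2)) ^ a else 0 := by
  have := isProbabilityMeasure_gammaMeasure ha hr
  have h : mgf id (gammaDiffLaw a r) t =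
      mgf id (gammaMeasure a r) t * mgf id (gammaMeasure a r) (-t) := by
    simp only [mgf, gammaDiffLaw]
    rw [integral_map (by fun_prop) (by fun_prop), ← integral_prod_mul]
    congr 1
    ext p
    rw [← Real.exp_add]
    simp only [id]
    ring_nf
  rw [h, mgf_gammaMeasure ha hr, mgf_gammaMeasure ha hr]
  by_cases ht : |t| < r
  · obtain ⟨h1, h2⟩ := abs_lt.1 ht
    rw [if_pos h2, if_pos (by linarith), if_pos ht, ← Real.mul_rpow (by
      have : 0 < r - t := by linarith
      positivity) (by
      have : 0 < r - -t := by linarith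
      positivity)]
    congr 1
    rw [div_mul_div_comm]
    ring_nf
  · rw [if_neg ht]
    rcases le_abs.1 (not_lt.1 ht) with h1 | h1
    · rw [if_neg (not_lt.2 h1), zero_mul]
    · rw [if_neg (not_lt.2 h1), mul_zero]

lemma zero_mem_interior_integrableExpSet_gammaDiffLaw {a r : ℝ} (ha : 0 < a) (hr : 0 < r) :
    (0 : ℝ) ∈ interior (integrableExpSet id (gammaDiffLaw a r)) := by
  have := isProbabilityMeasure_gammaDiffLaw ha hr
  refine mem_interior.2 ⟨Set.Ioo (-r) r, fun t ht => ?_, isOpen_Ioo, by simpa⟩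
  have ht' : |t| < r := abs_lt.2 ht
  -- A divergent integral has value 0, so positivity of the mgf proves integrability.
  refine mgf_pos_iff.1 ?_
  rw [mgf_gammaDiffLaw ha hr, if_pos ht']
  have : 0 < r ^ 2 - t ^ 2 := by nlinarith [ht.1, ht.2]
  positivity

/-- Gamma differences are stable under independent sums: `m` of them of shape `a` add up to one of
shape `m a`. -/
lemma map_sum_pi_gammaDiffLaw {ι : Type*} [Fintype ι] [Nonempty ι] {a r : ℝ} (ha : 0 < a)
    (hr : 0 < r) :
    (Measure.pi fun _ : ι => gammaDiffLaw a r).map (fun w => ∑ i, w i) =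
      gammaDiffLaw (Fintype.card ι * a) r := by
  have hm : 0 < (Fintype.card ι : ℝ) * a := by
    have : 0 < Fintype.card ι := Fintype.card_pos
    positivity
  have := isProbabilityMeasure_gammaDiffLaw ha hr
  have := isProbabilityMeasure_gammaDiffLaw hm hr
  have : IsProbabilityMeasure
      ((Measure.pi fun _ : ι => gammaDiffLaw a r).map (fun w => ∑ i, w i)) :=
    Measure.isProbabilityMeasure_map (by fun_prop)
  refine (measure_eq_of_mgf_eq (funext fun t => ?_)
    (zero_mem_interior_integrableExpSet_gammaDiffLaw hm hr)).symm
  have h : mgf id ((Measure.pi fun _ : ι => gammaDiffLaw a r).map (fun w => ∑ i, w i)) t =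
      mgf id (gammaDiffLaw a r) t ^ Fintype.card ι := by
    rw [mgf, integral_map (by fun_prop) (by fun_prop)]
    simp only [id, Finset.mul_sum, Real.exp_sum]
    rw [integral_fintype_prod_eq_prod (fun _ x => Real.exp (t * x)), Finset.prod_const]
    rfl
  rw [h, mgf_gammaDiffLaw hm hr, mgf_gammaDiffLaw ha hr]
  split_ifs with ht
  · have : 0 < r ^ 2 - t ^ 2 := by nlinarith [abs_lt.1 ht]
    rw [mul_comm, Real.rpow_mul_natCast (by positivity)]
  · rw [zero_pow Fintype.card_ne_zero]

/-- The coordinatewise sum of i.i.d. vectors with i.i.d. Gamma difference coordinates. -/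
lemma map_sum_pi_pi_gammaDiffLaw {ι κ : Type*} [Fintype ι] [Nonempty ι] [Fintype κ] {a r : ℝ}
    (ha : 0 < a) (hr : 0 < r) :
    (Measure.pi fun _ : ι => Measure.pi fun _ : κ => gammaDiffLaw a r).map (fun w => ∑ i, w i) =
      Measure.pi fun _ : κ => gammaDiffLaw (Fintype.card ι * a) r := by
  classical
  have hm : 0 < (Fintype.card ι : ℝ) * a := by
    have : 0 < Fintype.card ι := Fintype.card_pos
    positivity
  have := isProbabilityMeasure_gammaDiffLaw ha hr
  have := isProbabilityMeasure_gammaDiffLaw hm hr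
  have : IsProbabilityMeasure ((Measure.pi fun _ : ι => Measure.pi fun _ : κ =>
      gammaDiffLaw a r).map (fun w => ∑ i, w i)) :=
    Measure.isProbabilityMeasure_map (by fun_prop)
  refine Measure.ext_of_charFunDual (funext fun L => ?_)
  have h := charFunDual_map_sum_pi_eq_prod (μ := fun _ : ι => gammaDiffLaw a r)
  rw [map_sum_pi_gammaDiffLaw ha hr] at h
  -- The characteristic functional factors over teachers and over coordinates; swapping the two
  -- products reduces to the scalar case `h`.
  rw [charFunDual_map_sum_pi_eq_prod, Finset.prod_apply]
  simp_rw [charFunDual_pi, h, Finset.prod_apply]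
  exact Finset.prod_comm

/-! ### The kernel e^(-|v|) I(|v|) -/

/-- The kernel `v ↦ e^(-|v|) I(|v|)`, proportional to the density of a Gamma difference. -/
def kernelI (τ v : ℝ) : ℝ := Real.exp (-|v|) * funI τ |v|

lemma measurable_uncurry_integrandI (τ : ℝ) :
    Measurable fun p : ℝ × ℝ => integrandI τ p.1 p.2 := by
  unfold integrandI
  fun_prop

lemma measurable_funI (τ : ℝ) : Measurable (funI τ) :=
  ((measurable_uncurry_integrandI τ).stronglyMeasurable.integral_prod_right').measurable

lemma measurable_kernelI (τ : ℝ) : Measurable (kernelI τ) := by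
  have := measurable_funI τ
  unfold kernelI
  fun_prop

lemma integrandI_nonneg {τ v t : ℝ} (hv : 0 ≤ v) (ht : 0 < t) : 0 ≤ integrandI τ v t := by
  unfold integrandI
  positivity

lemma integrandI_antitone {τ v w t : ℝ} (hτ : τ < 1) (hv : 0 ≤ v) (hvw : v ≤ w) (ht : 0 < t) :
    integrandI τ w t ≤ integrandI τ v t := by
  unfold integrandI
  gcongr ?_ * _ * _
  exact Real.rpow_le_rpow_of_nonpos (by linarith) (by linarith) (by linarith)

lemma integrableOn_integrandI {τ v : ℝ} (hτ0 : 0 < τ) (hτ1 : τ < 1) (hv : 0 < v) :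
    IntegrableOn (integrandI τ v) (Set.Ioi 0) := by
  have h := (integrableOn_rpow_mul_exp_neg_mul_rpow (p := 1) (s := τ - 1) (b := 2)
    (by linarith) one_pos two_pos).const_mul (v ^ (τ - 1))
  refine h.mono' (by unfold integrandI; fun_prop) ?_
  refine (ae_restrict_iff' measurableSet_Ioi).2 (ae_of_all _ fun t ht => ?_)
  have ht0 : (0 : ℝ) < t := ht
  rw [Real.norm_of_nonneg (integrandI_nonneg hv.le ht0), integrandI, Real.rpow_one, mul_assoc]
  gcongr ?_ * _
  exact Real.rpow_le_rpow_of_nonpos hv (by linarith) (by linarith)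

/-- At v = 0 the two powers merge into t^(2τ - 2), integrable at the origin because τ > 1/2. -/
lemma integrableOn_integrandI_zero {τ : ℝ} (hτ : 1 / 2 < τ) :
    IntegrableOn (integrandI τ 0) (Set.Ioi 0) := by
  have h := integrableOn_rpow_mul_exp_neg_mul_rpow (p := 1) (s := (τ - 1) + (τ - 1)) (b := 2)
    (by linarith) one_pos two_pos
  refine h.congr_fun (fun t ht => ?_) measurableSet_Ioi
  have ht0 : (0 : ℝ) < t := ht
  simp only [integrandI, Real.rpow_one, add_zero, Real.rpow_add ht0]

lemma funI_pos {τ v : ℝ} (hτ0 : 0 < τ) (hτ1 : τ < 1) (hv : 0 < v) : 0 < funI τ v := by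
  unfold funI
  rw [setIntegral_pos_iff_support_of_nonneg_ae]
  · have : Set.Ioi (0 : ℝ) ⊆ Function.support (integrandI τ v) ∩ Set.Ioi 0 := by
      intro t ht
      have ht0 : (0 : ℝ) < t := ht
      refine ⟨ne_of_gt ?_, ht⟩
      unfold integrandI
      positivity
    exact lt_of_lt_of_le (by simp) (measure_mono this)
  · exact (ae_restrict_iff' measurableSet_Ioi).2
      (ae_of_all _ fun t ht => integrandI_nonneg hv.le ht)
  · exact integrableOn_integrandI hτ0 hτ1 hv

/-- Integrability at the smaller argument is a hypothesis so as to cover both v > 0 for every τ and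
v = 0 for τ > 1/2. If I(0) diverges, its formal value 0 would break monotonicity. -/
lemma funI_le_of_integrableOn {τ v w : ℝ} (hτ1 : τ < 1) (hv : 0 ≤ v) (hvw : v ≤ w)
    (hi : IntegrableOn (integrandI τ v) (Set.Ioi 0)) : funI τ w ≤ funI τ v := by
  have hle : ∀ t ∈ Set.Ioi (0 : ℝ), integrandI τ w t ≤ integrandI τ v t := fun t ht =>
    integrandI_antitone hτ1 hv hvw ht
  refine setIntegral_mono_on (hi.mono' (by unfold integrandI; fun_prop) ?_) hi
    measurableSet_Ioi hle
  refine (ae_restrict_iff' measurableSet_Ioi).2 (ae_of_all _ fun t ht => ?_)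
  rw [Real.norm_of_nonneg (integrandI_nonneg (hv.trans hvw) ht)]
  exact hle t ht

lemma kernelI_neg (τ v : ℝ) : kernelI τ (-v) = kernelI τ v := by
  simp [kernelI]

lemma kernelI_pos {τ v : ℝ} (hτ0 : 0 < τ) (hτ1 : τ < 1) (hv : v ≠ 0) : 0 < kernelI τ v :=
  mul_pos (Real.exp_pos _) (funI_pos hτ0 hτ1 (abs_pos.2 hv))

lemma funI_nonneg {τ v : ℝ} (hv : 0 ≤ v) : 0 ≤ funI τ v :=
  setIntegral_nonneg measurableSet_Ioi fun _ ht => integrandI_nonneg hv ht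

lemma kernelI_nonneg (τ v : ℝ) : 0 ≤ kernelI τ v :=
  mul_nonneg (Real.exp_pos _).le (funI_nonneg (abs_nonneg v))

lemma kernelI_le_of_integrableOn {τ v w : ℝ} (hτ1 : τ < 1) (hvw : |v| ≤ |w|)
    (hi : IntegrableOn (integrandI τ |v|) (Set.Ioi 0)) : kernelI τ w ≤ kernelI τ v := by
  unfold kernelI
  exact mul_le_mul (Real.exp_le_exp.2 (by linarith))
    (funI_le_of_integrableOn hτ1 (abs_nonneg v) hvw hi) (funI_nonneg (abs_nonneg w))
    (Real.exp_pos _).le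

/-! ### The density of a Gamma difference -/

/-- The convolution density of a Gamma difference. -/
def gammaDiffPDF (a r s : ℝ) : ENNReal := ∫⁻ y, gammaPDF a r y * gammaPDF a r (s + y)

lemma measurable_gammaPDF (a r : ℝ) : Measurable (gammaPDF a r) :=
  (measurable_gammaPDFReal a r).ennreal_ofReal

lemma gammaDiffLaw_apply (a r : ℝ) {B : Set ℝ} (hB : MeasurableSet B) :
    gammaDiffLaw a r B = ∫⁻ y, gammaPDF a r y * ∫⁻ s in B, gammaPDF a r (s + y) := by
  have hm := measurable_gammaPDF a r
  have : SFinite (gammaMeasure a r) := by unfold gammaMeasure; infer_instance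
  rw [gammaDiffLaw, Measure.map_apply (by fun_prop) hB,
    Measure.prod_apply_symm
      ((by fun_prop : Measurable fun p : ℝ × ℝ => p.1 - p.2) hB)]
  have h : ∀ y : ℝ, gammaMeasure a r
      ((fun x => (x, y)) ⁻¹' ((fun p : ℝ × ℝ => p.1 - p.2) ⁻¹' B)) =
      ∫⁻ s in B, gammaPDF a r (s + y) := by
    intro y
    have hset : MeasurableSet ((fun x => (x, y)) ⁻¹' ((fun p : ℝ × ℝ => p.1 - p.2) ⁻¹' B)) := by
      have : Measurable fun x : ℝ => x - y := by fun_prop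
      exact this hB
    rw [gammaMeasure, withDensity_apply _ hset, ← lintegral_indicator hset,
      ← lintegral_indicator hB, ← lintegral_add_right_eq_self _ y]
    congr 1
    ext s
    have hmem : (s + y ∈ (fun x => (x, y)) ⁻¹' ((fun p : ℝ × ℝ => p.1 - p.2) ⁻¹' B)) ↔ s ∈ B := by
      rw [Set.mem_preimage, Set.mem_preimage, add_sub_cancel_right]
    by_cases hs : s ∈ B
    · rw [Set.indicator_of_mem hs, Set.indicator_of_mem (hmem.2 hs)]
    · rw [Set.indicator_of_notMem hs, Set.indicator_of_notMem (mt hmem.1 hs)]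
  simp_rw [h]
  rw [gammaMeasure, lintegral_withDensity_eq_lintegral_mul₀ hm.aemeasurable]
  · rfl
  · have : Measurable fun y => ∫⁻ s in B, gammaPDF a r (s + y) :=
      Measurable.lintegral_prod_right' (f := fun p : ℝ × ℝ => gammaPDF a r (p.2 + p.1))
        (by fun_prop)
    exact this.aemeasurable

lemma gammaDiffLaw_eq_withDensity (a r : ℝ) :
    gammaDiffLaw a r = volume.withDensity (gammaDiffPDF a r) := by
  have hm := measurable_gammaPDF a r
  ext B hB
  rw [gammaDiffLaw_apply a r hB, withDensity_apply _ hB]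
  unfold gammaDiffPDF
  rw [lintegral_lintegral_swap (by fun_prop)]
  congr 1
  ext y
  rw [lintegral_const_mul _ (by fun_prop)]

lemma gammaDiffPDF_neg (a r s : ℝ) : gammaDiffPDF a r (-s) = gammaDiffPDF a r s := by
  unfold gammaDiffPDF
  rw [← lintegral_add_right_eq_self _ s]
  congr 1
  ext y
  rw [mul_comm]
  congr 2 <;> ring

lemma gammaPDFReal_mul_gammaPDFReal {a r s y : ℝ} (hr : 0 < r) (hs : 0 ≤ s) (hy : 0 < y) :
    gammaPDFReal a r y * gammaPDFReal a r (s + y) =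
      r ^ 2 / Real.Gamma a ^ 2 * Real.exp (-(r * s)) * integrandI a (r * s) (r * y) := by
  have h1 : r ^ a = r * r ^ (a - 1) := by
    rw [Real.rpow_sub_one hr.ne']
    field_simp
  have h2 : Real.exp (-(r * y)) * Real.exp (-(r * (s + y))) =
      Real.exp (-(r * s)) * Real.exp (-2 * (r * y)) := by
    rw [← Real.exp_add, ← Real.exp_add]
    ring_nf
  rw [gammaPDFReal, gammaPDFReal, if_pos hy.le, if_pos (by positivity), integrandI, ← mul_add,
    Real.mul_rpow hr.le (by positivity), Real.mul_rpow hr.le (by positivity), h1, add_comm y s]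
  linear_combination (r * r ^ (a - 1) / Real.Gamma a * y ^ (a - 1) *
    (r * r ^ (a - 1) / Real.Gamma a * (s + y) ^ (a - 1))) * h2

/-- By symmetry s > 0; the substitution t = ry then turns the convolution into I(rs). The point s =
0, where I may diverge, is negligible for the law. -/
lemma gammaDiffPDF_eq {a r s : ℝ} (ha0 : 0 < a) (ha1 : a < 1) (hr : 0 < r) (hs : s ≠ 0) :
    gammaDiffPDF a r s = ENNReal.ofReal (r / Real.Gamma a ^ 2 * kernelI a (r * s)) := by
  wlog hs0 : 0 < s generalizing s
  · rw [← gammaDiffPDF_neg, this (neg_ne_zero.2 hs)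
      (by rcases lt_or_gt_of_ne hs with h | h <;> [linarith; exact absurd h hs0]),
      mul_neg, kernelI_neg]
  have hrs : 0 < r * s := by positivity
  have h1 : gammaDiffPDF a r s = ∫⁻ y in Set.Ioi (0 : ℝ), ENNReal.ofReal
      (r ^ 2 / Real.Gamma a ^ 2 * Real.exp (-(r * s)) * integrandI a (r * s) (r * y)) := by
    rw [gammaDiffPDF, ← lintegral_indicator measurableSet_Ioi]
    refine lintegral_congr_ae ?_
    filter_upwards [Measure.ae_ne volume (0 : ℝ)] with y hy
    rcases lt_or_gt_of_ne hy with h | h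
    · rw [gammaPDF_of_neg h, zero_mul, Set.indicator_of_notMem (by simpa using h.le)]
    · rw [Set.indicator_of_mem (Set.mem_Ioi.2 h), gammaPDF, gammaPDF,
        ← ENNReal.ofReal_mul (gammaPDFReal_nonneg ha0 hr y),
        gammaPDFReal_mul_gammaPDFReal hr hs0.le h]
  have h2 : IntegrableOn (fun y => integrandI a (r * s) (r * y)) (Set.Ioi 0) := by
    have := (integrableOn_integrandI ha0 ha1 hrs)
    rw [integrableOn_Ioi_comp_mul_left_iff _ _ hr, mul_zero]
    exact this
  rw [h1, ← ofReal_integral_eq_lintegral_ofReal (h2.const_mul _), integral_const_mul,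
    integral_comp_mul_left_Ioi _ _ hr, mul_zero, kernelI, abs_of_pos hrs, funI, smul_eq_mul]
  · congr 1
    field_simp
  · refine (ae_restrict_iff' measurableSet_Ioi).2 (ae_of_all _ fun t ht => ?_)
    have ht0 : (0 : ℝ) < t := ht
    have := integrandI_nonneg (τ := a) hrs.le (mul_pos hr ht0)
    positivity

lemma gammaDiffLaw_apply_kernelI {a r : ℝ} (ha0 : 0 < a) (ha1 : a < 1) (hr : 0 < r)
    {B : Set ℝ} (hB : MeasurableSet B) :
    gammaDiffLaw a r B =
      ∫⁻ s in B, ENNReal.ofReal (r / Real.Gamma a ^ 2 * kernelI a (r * s)) := by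
  rw [gammaDiffLaw_eq_withDensity, withDensity_apply _ hB]
  refine lintegral_congr_ae (ae_restrict_of_ae ?_)
  filter_upwards [Measure.ae_ne volume (0 : ℝ)] with s hs using gammaDiffPDF_eq ha0 ha1 hr hs

/-- No estimate of I is needed: up to a constant the kernel is the density of a probability measure.
-/
lemma integrable_kernelI {τ : ℝ} (hτ0 : 0 < τ) (hτ1 : τ < 1) : Integrable (kernelI τ) := by
  have hΓ := Real.Gamma_pos_of_pos hτ0
  have h := gammaDiffLaw_apply_kernelI hτ0 hτ1 one_pos MeasurableSet.univ
  have := isProbabilityMeasure_gammaDiffLaw hτ0 one_pos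
  rw [measure_univ, Measure.restrict_univ] at h
  have h2 : Integrable fun s => 1 / Real.Gamma τ ^ 2 * kernelI τ (1 * s) := by
    refine ⟨(((measurable_kernelI τ).comp (measurable_const_mul 1)).const_mul
      _).aestronglyMeasurable, ?_⟩
    rw [hasFiniteIntegral_iff_ofReal, ← h]
    · simp
    · refine ae_of_all _ fun s => ?_
      have := kernelI_nonneg τ (1 * s)
      positivity
  refine (h2.const_mul (Real.Gamma τ ^ 2)).congr (ae_of_all _ fun s => ?_)
  simp only [one_mul]
  field_simp

lemma tail_eq (τ s : ℝ) : tail τ s = ∫ v in Set.Ioi s, kernelI τ v := rfl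

lemma gammaDiffLaw_real_Ioi {τ r : ℝ} (hτ0 : 0 < τ) (hτ1 : τ < 1) (hr : 0 < r) (s : ℝ) :
    (gammaDiffLaw τ r).real (Set.Ioi s) = tail τ (r * s) / Real.Gamma τ ^ 2 := by
  have hΓ := Real.Gamma_pos_of_pos hτ0
  have h0 : ∀ v, 0 ≤ r / Real.Gamma τ ^ 2 * kernelI τ (r * v) := fun v => by
    have := kernelI_nonneg τ (r * v)
    positivity
  have hi : Integrable fun v => r / Real.Gamma τ ^ 2 * kernelI τ (r * v) :=
    (((integrable_kernelI hτ0 hτ1).comp_mul_left' hr.ne').const_mul _)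
  rw [Measure.real, gammaDiffLaw_apply_kernelI hτ0 hτ1 hr measurableSet_Ioi,
    ← ofReal_integral_eq_lintegral_ofReal hi.integrableOn (ae_of_all _ h0),
    ENNReal.toReal_ofReal (integral_nonneg h0), integral_const_mul,
    integral_comp_mul_left_Ioi _ _ hr, tail_eq, smul_eq_mul]
  field_simp

lemma integral_kernelI {τ : ℝ} (hτ0 : 0 < τ) (hτ1 : τ < 1) :
    ∫ v, kernelI τ v = Real.Gamma τ ^ 2 := by
  have hΓ := Real.Gamma_pos_of_pos hτ0
  have := isProbabilityMeasure_gammaDiffLaw hτ0 one_pos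
  have h0 : ∀ v, 0 ≤ 1 / Real.Gamma τ ^ 2 * kernelI τ (1 * v) := fun v => by
    have := kernelI_nonneg τ (1 * v)
    positivity
  have hi : Integrable fun v => 1 / Real.Gamma τ ^ 2 * kernelI τ (1 * v) :=
    (((integrable_kernelI hτ0 hτ1).comp_mul_left' one_ne_zero).const_mul _)
  have h := gammaDiffLaw_apply_kernelI hτ0 hτ1 one_pos MeasurableSet.univ
  rw [measure_univ, Measure.restrict_univ, ← ofReal_integral_eq_lintegral_ofReal hi
    (ae_of_all _ h0), integral_const_mul, eq_comm, ENNReal.ofReal_eq_one] at h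
  simp only [one_mul] at h
  field_simp at h
  exact h

/-! ### Log-convexity of the tail -/

/-- The Gamma density of shape at most one is log-convex. -/
lemma gammaPDFReal_le_rpow_mul_rpow {a r x y α β : ℝ} (ha0 : 0 < a) (ha1 : a ≤ 1) (hr : 0 < r)
    (hx : 0 < x) (hy : 0 < y) (hα : 0 ≤ α) (hβ : 0 ≤ β) (hαβ : α + β = 1) :
    gammaPDFReal a r (α * x + β * y) ≤ gammaPDFReal a r x ^ α * gammaPDFReal a r y ^ β := by
  have hexp : ∀ z, 0 < z → gammaPDFReal a r z =
      Real.exp (Real.log (r ^ a / Real.Gamma a) + (a - 1) * Real.log z - r * z) := by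
    intro z hz
    have hΓ := Real.Gamma_pos_of_pos ha0
    rw [gammaPDFReal, if_pos hz.le, sub_eq_add_neg _ (r * z), Real.exp_add, Real.exp_add,
      Real.exp_log (by positivity), Real.rpow_def_of_pos hz, mul_comm (Real.log z)]
  have hz : 0 < α * x + β * y := by
    rcases hα.eq_or_lt with h | h
    · have : β = 1 := by linarith
      subst this
      subst h
      simpa
    · positivity
  have hlog := strictConcaveOn_log_Ioi.concaveOn.2 (Set.mem_Ioi.2 hx) (Set.mem_Ioi.2 hy) hα hβ hαβ
  simp only [smul_eq_mul] at hlog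
  rw [hexp _ hz, hexp _ hx, hexp _ hy, ← Real.exp_mul, ← Real.exp_mul, ← Real.exp_add]
  refine Real.exp_le_exp.2 ?_
  have h1 := mul_le_mul_of_nonneg_left hlog (sub_nonneg.2 ha1)
  have h2 : Real.log (r ^ a / Real.Gamma a) =
      (α + β) * Real.log (r ^ a / Real.Gamma a) := by rw [hαβ, one_mul]
  nlinarith

/-- The tail function of a Gamma difference of shape at most one is log-convex on the positive
half line. -/
lemma gammaDiffLaw_Ioi_le_rpow_mul_rpow {a r s t α β : ℝ} (ha0 : 0 < a) (ha1 : a ≤ 1)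
    (hr : 0 < r) (hs : 0 ≤ s) (ht : 0 ≤ t) (hα : 0 ≤ α) (hβ : 0 ≤ β) (hαβ : α + β = 1) :
    gammaDiffLaw a r (Set.Ioi (α * s + β * t)) ≤
      gammaDiffLaw a r (Set.Ioi s) ^ α * gammaDiffLaw a r (Set.Ioi t) ^ β := by
  have hm := measurable_gammaPDF a r
  set φ : ℝ → ℝ × ℝ → ENNReal := fun s p => gammaPDF a r p.1 * gammaPDF a r (p.2 + s + p.1)
  have hφm : ∀ s, Measurable (φ s) := fun s => by fun_prop
  -- Translating the half line by s puts all dependence on s in the integrand, over a fixed domain,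
  -- as Hölder requires.
  have hF : ∀ s, gammaDiffLaw a r (Set.Ioi s) =
      ∫⁻ p, φ s p ∂(volume.prod (volume.restrict (Set.Ioi (0 : ℝ)))) := by
    intro s
    rw [gammaDiffLaw_apply a r measurableSet_Ioi, lintegral_prod _ (hφm s).aemeasurable]
    refine lintegral_congr fun y => ?_
    simp only [φ]
    rw [lintegral_const_mul _ (by fun_prop), ← lintegral_indicator measurableSet_Ioi,
      ← lintegral_indicator measurableSet_Ioi, ← lintegral_add_right_eq_self _ s]
    congr 2
    ext v
    simp [Set.indicator]
  rw [hF, hF, hF]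
  refine le_trans (lintegral_mono_ae ?_) (ENNReal.lintegral_mul_norm_pow_le
    (hφm s).aemeasurable (hφm t).aemeasurable hα hβ hαβ)
  have hae : ∀ᵐ p ∂((volume : Measure ℝ).prod (volume.restrict (Set.Ioi (0 : ℝ)))),
      0 < p.2 := by
    refine Measure.ae_prod_mem_iff_ae_ae_mem (s := {p | 0 < p.2}) ?_ |>.2 ?_
    · exact measurableSet_lt measurable_const measurable_snd
    · exact ae_of_all _ fun _ => ae_restrict_mem measurableSet_Ioi
  filter_upwards [hae] with p hp
  rcases lt_or_ge p.1 0 with h | h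
  · simp [φ, gammaPDF_of_neg h]
  have hx : 0 < p.2 + s + p.1 := by linarith
  have hy : 0 < p.2 + t + p.1 := by linarith
  have hf := fun z => gammaPDFReal_nonneg ha0 hr z
  have key : gammaPDF a r (p.2 + (α * s + β * t) + p.1) ≤
      gammaPDF a r (p.2 + s + p.1) ^ α * gammaPDF a r (p.2 + t + p.1) ^ β := by
    unfold gammaPDF
    rw [ENNReal.ofReal_rpow_of_nonneg (hf _) hα, ENNReal.ofReal_rpow_of_nonneg (hf _) hβ,
      ← ENNReal.ofReal_mul (Real.rpow_nonneg (hf _) _)]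
    refine ENNReal.ofReal_le_ofReal ?_
    convert gammaPDFReal_le_rpow_mul_rpow ha0 ha1 hr hx hy hα hβ hαβ using 2
    linear_combination (-p.2 - p.1) * hαβ
  calc φ (α * s + β * t) p
      = gammaPDF a r p.1 ^ (α + β) * gammaPDF a r (p.2 + (α * s + β * t) + p.1) := by
        rw [hαβ, ENNReal.rpow_one]
    _ ≤ gammaPDF a r p.1 ^ (α + β) *
        (gammaPDF a r (p.2 + s + p.1) ^ α * gammaPDF a r (p.2 + t + p.1) ^ β) := by gcongr
    _ = φ s p ^ α * φ t p ^ β := by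
        rw [ENNReal.rpow_add_of_nonneg _ _ hα hβ, ENNReal.mul_rpow_of_nonneg _ _ hα,
          ENNReal.mul_rpow_of_nonneg _ _ hβ]
        ring

/-- The hazard rate of a Gamma difference of shape at most one is decreasing on the positive half
line. -/
lemma gammaDiffLaw_Ioi_mul_le {a r s t : ℝ} (ha0 : 0 < a) (ha1 : a ≤ 1) (hr : 0 < r)
    (hs : 0 ≤ s) (ht : 0 ≤ t) :
    gammaDiffLaw a r (Set.Ioi s) * gammaDiffLaw a r (Set.Ioi t) ≤
      gammaDiffLaw a r (Set.Ioi 0) * gammaDiffLaw a r (Set.Ioi (s + t)) := by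
  rcases hs.eq_or_lt with rfl | hs'
  · rw [zero_add]
  have hst : 0 < s + t := by linarith
  -- Both s and t are convex combinations of 0 and s + t, with weights exchanged; in the product of
  -- the two bounds the exponents add up to 1.
  have hsum : t / (s + t) + s / (s + t) = 1 := by field_simp; ring
  have hα : 0 ≤ t / (s + t) := by positivity
  have hβ : 0 ≤ s / (s + t) := by positivity
  have h1 := gammaDiffLaw_Ioi_le_rpow_mul_rpow ha0 ha1 hr le_rfl hst.le hα hβ hsum
  have h2 := gammaDiffLaw_Ioi_le_rpow_mul_rpow ha0 ha1 hr le_rfl hst.le hβ hα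
    (by rw [add_comm]; exact hsum)
  rw [mul_zero, zero_add, div_mul_cancel₀ _ hst.ne'] at h1 h2
  refine (mul_le_mul' h1 h2).trans_eq ?_
  rw [mul_mul_mul_comm, ← ENNReal.rpow_add_of_nonneg _ _ hα hβ,
    ← ENNReal.rpow_add_of_nonneg _ _ hβ hα, add_comm (s / (s + t)), hsum, ENNReal.rpow_one,
    ENNReal.rpow_one]

lemma tail_mul_tail_le {τ s t : ℝ} (hτ0 : 0 < τ) (hτ1 : τ < 1) (hs : 0 ≤ s) (ht : 0 ≤ t) :
    tail τ s * tail τ t ≤ tail τ 0 * tail τ (s + t) := by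
  have hΓ := Real.Gamma_pos_of_pos hτ0
  have := isProbabilityMeasure_gammaDiffLaw hτ0 one_pos
  have h := ENNReal.toReal_mono (by finiteness)
    (gammaDiffLaw_Ioi_mul_le hτ0 hτ1.le one_pos hs ht)
  have hT : ∀ u, tail τ u = Real.Gamma τ ^ 2 * (gammaDiffLaw τ 1).real (Set.Ioi u) := fun u => by
    rw [gammaDiffLaw_real_Ioi hτ0 hτ1 one_pos, one_mul]
    field_simp
  rw [ENNReal.toReal_mul, ENNReal.toReal_mul] at h
  simp only [hT, Measure.real]
  calc _ = Real.Gamma τ ^ 4 * ((gammaDiffLaw τ 1 (Set.Ioi s)).toReal *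
        (gammaDiffLaw τ 1 (Set.Ioi t)).toReal) := by ring
    _ ≤ Real.Gamma τ ^ 4 * ((gammaDiffLaw τ 1 (Set.Ioi 0)).toReal *
        (gammaDiffLaw τ 1 (Set.Ioi (s + t))).toReal) := by gcongr
    _ = _ := by ring

/-! ### Bounds on the ratio T(s)/T(s + 2b) -/

variable {τ : ℝ}

lemma kernelI_le (hτ0 : 0 < τ) (hτ1 : τ < 1) {v w : ℝ} (hv : v ≠ 0) (hvw : |v| ≤ |w|) :
    kernelI τ w ≤ kernelI τ v :=
  kernelI_le_of_integrableOn hτ1 hvw (integrableOn_integrandI hτ0 hτ1 (abs_pos.2 hv))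

lemma kernelI_le_of_half_lt (hτ : 1 / 2 < τ) (hτ1 : τ < 1) {v w : ℝ} (hvw : |v| ≤ |w|) :
    kernelI τ w ≤ kernelI τ v := by
  rcases eq_or_ne v 0 with rfl | hv
  · exact kernelI_le_of_integrableOn hτ1 hvw (by simpa using integrableOn_integrandI_zero hτ)
  · exact kernelI_le (by linarith) hτ1 hv hvw

lemma continuous_kernelI (hτ : 1 / 2 < τ) (hτ1 : τ < 1) : Continuous (kernelI τ) := by
  have h : Continuous fun v : ℝ => funI τ |v| := by
    refine continuous_of_dominated (bound := integrandI τ 0)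
      (fun v => by unfold integrandI; fun_prop) (fun v => ?_) (integrableOn_integrandI_zero hτ) ?_
    · refine (ae_restrict_iff' measurableSet_Ioi).2 (ae_of_all _ fun t ht => ?_)
      rw [Real.norm_of_nonneg (integrandI_nonneg (abs_nonneg v) ht)]
      exact integrandI_antitone hτ1 le_rfl (abs_nonneg v) ht
    · refine (ae_restrict_iff' measurableSet_Ioi).2 (ae_of_all _ fun t ht => ?_)
      have ht0 : (0 : ℝ) < t := ht
      unfold integrandI
      refine ((Continuous.rpow_const (by fun_prop) fun v => Or.inl ?_).mul
        continuous_const).mul continuous_const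
      positivity
  exact (by fun_prop : Continuous fun v : ℝ => Real.exp (-|v|)).mul h

lemma tail_sub_tail (hτ0 : 0 < τ) (hτ1 : τ < 1) (s t : ℝ) :
    tail τ s - tail τ t = ∫ v in s..t, kernelI τ v :=
  intervalIntegral.integral_Ioi_sub_Ioi' (integrable_kernelI hτ0 hτ1).integrableOn
    (integrable_kernelI hτ0 hτ1).integrableOn

lemma tail_neg_add_tail (hτ0 : 0 < τ) (hτ1 : τ < 1) (s : ℝ) :
    tail τ (-s) + tail τ s = Real.Gamma τ ^ 2 := by
  have hi := integrable_kernelI hτ0 hτ1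
  have h : tail τ (-s) = ∫ v in Set.Iic s, kernelI τ v := by
    rw [tail_eq, ← integral_comp_neg_Iic]
    simp_rw [kernelI_neg]
  rw [h, tail_eq, ← integral_kernelI hτ0 hτ1]
  exact intervalIntegral.integral_Iic_add_Ioi hi.integrableOn hi.integrableOn

lemma tail_zero (hτ0 : 0 < τ) (hτ1 : τ < 1) : tail τ 0 = Real.Gamma τ ^ 2 / 2 := by
  have := tail_neg_add_tail hτ0 hτ1 0
  rw [neg_zero] at this
  linarith

lemma tail_antitone (hτ0 : 0 < τ) (hτ1 : τ < 1) : Antitone (tail τ) := by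
  intro s t hst
  have := tail_sub_tail hτ0 hτ1 s t
  have : 0 ≤ ∫ v in s..t, kernelI τ v :=
    intervalIntegral.integral_nonneg hst fun v _ => kernelI_nonneg τ v
  linarith

lemma tail_pos (hτ0 : 0 < τ) (hτ1 : τ < 1) (s : ℝ) : 0 < tail τ s := by
  refine lt_of_lt_of_le ?_ (tail_antitone hτ0 hτ1 (le_max_left s 0))
  rw [tail_eq, setIntegral_pos_iff_support_of_nonneg_ae
    (ae_of_all _ fun v => kernelI_nonneg τ v) (integrable_kernelI hτ0 hτ1).integrableOn]
  have : Set.Ioi (max s 0) ⊆ Function.support (kernelI τ) ∩ Set.Ioi (max s 0) := fun v hv =>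
    ⟨(kernelI_pos hτ0 hτ1 ((le_max_right s 0).trans_lt hv).ne').ne', hv⟩
  exact lt_of_lt_of_le (by simp) (measure_mono this)

/-- Among two windows of the same length, the one closer to the origin has the larger mass. -/
lemma tail_sub_tail_le (hτ0 : 0 < τ) (hτ1 : τ < 1) {c d w : ℝ} (hw : 0 ≤ w)
    (h : ∀ u, 0 < u → u < w → |d + u| ≤ |c + u|) :
    tail τ c - tail τ (c + w) ≤ tail τ d - tail τ (d + w) := by
  have hi := integrable_kernelI hτ0 hτ1
  rw [tail_sub_tail hτ0 hτ1, tail_sub_tail hτ0 hτ1]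
  have hs : ∀ e, ∫ v in e..e + w, kernelI τ v = ∫ u in (0 : ℝ)..w, kernelI τ (e + u) := fun e => by
    rw [intervalIntegral.integral_comp_add_left (fun v => kernelI τ v), add_zero]
  rw [hs, hs, intervalIntegral.integral_of_le hw, intervalIntegral.integral_of_le hw,
    integral_Ioc_eq_integral_Ioo, integral_Ioc_eq_integral_Ioo]
  refine setIntegral_mono_ae_restrict (hi.comp_add_left c).integrableOn
    (hi.comp_add_left d).integrableOn ?_
  -- The point u = -d is discarded: the kernel is evaluated at 0 there, where monotonicity fails if
  -- I(0) diverges.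
  filter_upwards [ae_restrict_mem measurableSet_Ioo,
    ae_restrict_of_ae (Measure.ae_ne volume (-d))] with u hu hud
  exact kernelI_le hτ0 hτ1 (fun h0 => hud (by linarith)) (h u hu.1 hu.2)

variable {b s : ℝ}

/-- Going from -b to s, the numerator T(-b) grows by some δ ≥ 0 and the denominator T(b) by at least
δ, since the window of the denominator is closer to the origin. As T(-b) ≥ T(b), the ratio cannot
increase. -/
lemma tail_mul_tail_le_of_le_neg (hτ0 : 0 < τ) (hτ1 : τ < 1) (hb : 0 < b) (hs : s ≤ -b) :
    tail τ s * tail τ b ≤ tail τ (-b) * tail τ (s + 2 * b) := by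
  have h := tail_sub_tail_le hτ0 hτ1 (c := b) (d := -b) (w := -b - s) (by linarith)
    fun u hu _ => by rw [abs_of_pos (by linarith : 0 < b + u)]; exact abs_le.2 ⟨by linarith, by linarith⟩
  have h1 := tail_neg_add_tail hτ0 hτ1 s
  have h2 := tail_neg_add_tail hτ0 hτ1 b
  have h3 := tail_neg_add_tail hτ0 hτ1 (s + 2 * b)
  rw [show b + (-b - s) = -s by ring, show -b + (-b - s) = -(s + 2 * b) by ring] at h
  have h4 := tail_antitone hτ0 hτ1 (by linarith : -b ≤ b)
  have h5 : tail τ s - tail τ (-b) ≤ tail τ (s + 2 * b) - tail τ b := by linarith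
  have h6 := tail_antitone hτ0 hτ1 hs
  have h7 := tail_pos hτ0 hτ1 b
  nlinarith

/-- Trading [b, s + 2b] for [-b, s], of the same length and closer to the origin, replaces the
window by the centred one [-b, b], whose mass is the right-hand side. -/
lemma tail_sub_tail_le_of_neg_le (hτ0 : 0 < τ) (hτ1 : τ < 1) (hb : 0 < b) (hs : -b ≤ s) :
    tail τ s - tail τ (s + 2 * b) ≤ 2 * (tail τ 0 - tail τ b) := by
  have h := tail_sub_tail_le hτ0 hτ1 (c := b) (d := -b) (w := b + s) (by linarith)
    fun u hu _ => by rw [abs_of_pos (by linarith : 0 < b + u)]; exact abs_le.2 ⟨by linarith, by linarith⟩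
  rw [show b + (b + s) = s + 2 * b by ring, show -b + (b + s) = s by ring] at h
  have h2 := tail_neg_add_tail hτ0 hτ1 b
  have h3 := tail_zero hτ0 hτ1
  linarith

/-- The likelihood ratio of the exceedances of `s` and `s + 2 b` is bounded, for all real `s`. -/
lemma tail_le_mul_tail (hτ0 : 0 < τ) (hτ1 : τ < 1) (hb : 0 < b) (s : ℝ) :
    tail τ s ≤ (1 + 2 * ((tail τ 0 - tail τ b) / tail τ (2 * b))) * tail τ (s + 2 * b) := by
  have hT2 := tail_pos hτ0 hτ1 (2 * b)
  have hTb := tail_pos hτ0 hτ1 b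
  have hTs := tail_pos hτ0 hτ1 (s + 2 * b)
  have hJ : 0 ≤ tail τ 0 - tail τ b := sub_nonneg.2 (tail_antitone hτ0 hτ1 hb.le)
  have hb2 : tail τ (2 * b) ≤ tail τ b := tail_antitone hτ0 hτ1 (by linarith)
  rw [← mul_div_assoc, one_add_div hT2.ne', div_mul_eq_mul_div, le_div_iff₀ hT2]
  rcases le_total s (-b) with h | h
  · have h1 := tail_mul_tail_le_of_le_neg hτ0 hτ1 hb h
    have h2 : tail τ (-b) = tail τ b + 2 * (tail τ 0 - tail τ b) := by
      have h2 := tail_neg_add_tail hτ0 hτ1 b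
      have h3 := tail_zero hτ0 hτ1
      linarith
    rw [h2] at h1
    -- The ratio at -b is 1 + 2(T(0) - T(b))/T(b), and T(2b) ≤ T(b).
    refine le_of_mul_le_mul_right ?_ hTb
    nlinarith [mul_nonneg (mul_nonneg hJ hTs.le) (sub_nonneg.2 hb2)]
  · rcases le_total s 0 with h0 | h0
    · have h1 := tail_sub_tail_le_of_neg_le hτ0 hτ1 hb h
      have h2 : tail τ (2 * b) ≤ tail τ (s + 2 * b) := tail_antitone hτ0 hτ1 (by linarith)
      nlinarith
    · have h1 := tail_mul_tail_le hτ0 hτ1 h0 (by positivity : 0 ≤ 2 * b)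
      have h2 := tail_sub_tail_le_of_neg_le hτ0 hτ1 hb (by linarith : -b ≤ 0)
      rw [zero_add] at h2
      nlinarith

lemma mul_kernelI_le_tail_sub_tail (hτ : 1 / 2 < τ) (hτ1 : τ < 1) {c u : ℝ} (hc : 0 ≤ c)
    (hu : 0 ≤ u) :
    u * kernelI τ (c + u) ≤ tail τ c - tail τ (c + u) ∧
      tail τ c - tail τ (c + u) ≤ u * kernelI τ c := by
  have hle : c ≤ c + u := by linarith
  have hq : ∀ v w : ℝ, 0 ≤ v → v ≤ w → kernelI τ w ≤ kernelI τ v := fun v w h0 h =>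
    kernelI_le_of_half_lt hτ hτ1 (by rwa [abs_of_nonneg h0, abs_of_nonneg (h0.trans h)])
  have hi : IntervalIntegrable (kernelI τ) volume c (c + u) :=
    (integrable_kernelI (by linarith) hτ1).intervalIntegrable
  rw [tail_sub_tail (by linarith) hτ1]
  constructor
  · have := intervalIntegral.integral_mono_on hle (intervalIntegrable_const (c := kernelI τ (c + u)))
      hi fun v hv => hq v (c + u) (hc.trans hv.1) hv.2
    simpa using this
  · have := intervalIntegral.integral_mono_on hle hi (intervalIntegrable_const (c := kernelI τ c))
      fun v hv => hq c v hc hv.1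
    simpa using this

/-- The hazard rate kernel/T at 2b is at most that at 0. This is the limit s → 0+ of
`tail_mul_tail_le`, both increments of T being bounded by s times a kernel value. -/
lemma tail_mul_kernelI_le (hτ : 1 / 2 < τ) (hτ1 : τ < 1) (hb : 0 < b) :
    tail τ 0 * kernelI τ (2 * b) ≤ kernelI τ 0 * tail τ (2 * b) := by
  have hτ0 : 0 < τ := by linarith
  have key : ∀ s, 0 < s → tail τ 0 * kernelI τ (2 * b + s) ≤ kernelI τ 0 * tail τ (2 * b) := by
    intro s hs
    have h1 := tail_mul_tail_le hτ0 hτ1 hs.le (by positivity : 0 ≤ 2 * b)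
    have h2 := (mul_kernelI_le_tail_sub_tail hτ hτ1 le_rfl hs.le).2
    have h3 := (mul_kernelI_le_tail_sub_tail hτ hτ1 (by positivity : 0 ≤ 2 * b) hs.le).1
    rw [zero_add] at h2
    rw [add_comm s] at h1
    have hT0 := tail_pos hτ0 hτ1 0
    have hT2 := tail_pos hτ0 hτ1 (2 * b)
    refine le_of_mul_le_mul_left ?_ hs
    nlinarith
  have hcont : Filter.Tendsto (fun s => tail τ 0 * kernelI τ (2 * b + s))
      (nhdsWithin 0 (Set.Ioi 0)) (nhds (tail τ 0 * kernelI τ (2 * b))) := by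
    have hk := continuous_kernelI hτ hτ1
    have : Continuous fun s => tail τ 0 * kernelI τ (2 * b + s) := by fun_prop
    simpa using (this.tendsto 0).mono_left nhdsWithin_le_nhds
  exact le_of_tendsto hcont (Filter.eventually_of_mem self_mem_nhdsWithin key)

/-- A sharper bound on the ratio, from the tangent line at the origin. -/
lemma tail_le_tangent_mul_tail (hτ : 1 / 2 < τ) (hτ1 : τ < 1) (hb : 0 < b) (s : ℝ) :
    tail τ s ≤ (tail τ 0 / tail τ (2 * b) -
      b * ((tail τ 0 * kernelI τ (2 * b) - kernelI τ 0 * tail τ (2 * b)) / tail τ (2 * b) ^ 2)) *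
        tail τ (s + 2 * b) := by
  have hτ0 : 0 < τ := by linarith
  have hT2 := tail_pos hτ0 hτ1 (2 * b)
  have hT0 := tail_pos hτ0 hτ1 0
  have hW := tail_mul_kernelI_le hτ hτ1 hb
  -- C is the value at s = -b of the tangent at 0 to s ↦ T(s)/T(s + 2b).
  set C := tail τ 0 / tail τ (2 * b) -
      b * ((tail τ 0 * kernelI τ (2 * b) - kernelI τ 0 * tail τ (2 * b)) / tail τ (2 * b) ^ 2)
    with hC
  have hC2 : C * tail τ (2 * b) ^ 2 = tail τ 0 * tail τ (2 * b) +
      b * (kernelI τ 0 * tail τ (2 * b) - tail τ 0 * kernelI τ (2 * b)) := by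
    rw [hC]
    field_simp
    ring
  have hmid : ∀ s, -b ≤ s → s ≤ 0 → tail τ s ≤ C * tail τ (s + 2 * b) := by
    intro s h1 h2
    have hu : 0 ≤ -s := by linarith
    have h3 := (mul_kernelI_le_tail_sub_tail hτ hτ1 le_rfl hu).2
    have h4 := (mul_kernelI_le_tail_sub_tail hτ hτ1 (by linarith : 0 ≤ s + 2 * b) hu).1
    have h5 := tail_neg_add_tail hτ0 hτ1 s
    have h6 := tail_zero hτ0 hτ1
    rw [zero_add] at h3
    rw [show s + 2 * b + -s = 2 * b by ring] at h4
    set u := -s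
    have hq0 := kernelI_nonneg τ 0
    have hq2 := kernelI_nonneg τ (2 * b)
    have h7 : tail τ s ≤ tail τ 0 + u * kernelI τ 0 := by linarith
    have h8 : tail τ (2 * b) + u * kernelI τ (2 * b) ≤ tail τ (s + 2 * b) := by linarith
    have hub : u ≤ b := by simp only [u]; linarith
    have hCpos : 0 ≤ C := by
      refine le_of_mul_le_mul_right ?_ (pow_pos hT2 2)
      rw [hC2, zero_mul]
      have := mul_nonneg hb.le (sub_nonneg.2 hW)
      positivity
    refine h7.trans (le_trans ?_ (mul_le_mul_of_nonneg_left h8 hCpos))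
    refine le_of_mul_le_mul_right ?_ (pow_pos hT2 2)
    have hW' := sub_nonneg.2 hW
    rw [mul_right_comm, hC2]
    set T0 := tail τ 0
    set T2 := tail τ (2 * b)
    set q0 := kernelI τ 0
    set q2 := kernelI τ (2 * b)
    -- The bound (T0 + u q0)/(T2 + u q2) is concave in u because q0 T2 ≥ T0 q2, so it lies below its
    -- tangent at u = 0; that tangent increases, and u ≤ b.
    have e : (T0 * T2 + b * (q0 * T2 - T0 * q2)) * (T2 + u * q2) - (T0 + u * q0) * T2 ^ 2 =
        (b - u) * T2 * (q0 * T2 - T0 * q2) + b * (q0 * T2 - T0 * q2) * (u * q2) := by ring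
    have : 0 ≤ (b - u) * T2 * (q0 * T2 - T0 * q2) + b * (q0 * T2 - T0 * q2) * (u * q2) := by
      have := sub_nonneg.2 hub
      positivity
    linarith
  rcases le_total s (-b) with h | h
  · have h1 := tail_mul_tail_le_of_le_neg hτ0 hτ1 hb h
    have h2 := hmid (-b) le_rfl (by linarith)
    rw [show -b + 2 * b = b by ring] at h2
    have hTs := tail_pos hτ0 hτ1 (s + 2 * b)
    refine le_of_mul_le_mul_right ?_ (tail_pos hτ0 hτ1 b)
    nlinarith
  · rcases le_total s 0 with h0 | h0
    · exact hmid s h h0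
    · have h1 := tail_mul_tail_le hτ0 hτ1 h0 (by positivity : 0 ≤ 2 * b)
      have h2 := hmid 0 (by linarith) le_rfl
      rw [zero_add] at h2
      have hTs := tail_pos hτ0 hτ1 (s + 2 * b)
      refine le_of_mul_le_mul_right ?_ hT2
      nlinarith

lemma hasDerivAt_tail (hτ : 1 / 2 < τ) (hτ1 : τ < 1) (s : ℝ) :
    HasDerivAt (tail τ) (-kernelI τ s) s := by
  have hk := continuous_kernelI hτ hτ1
  have h : tail τ = fun t => tail τ 0 - ∫ v in (0 : ℝ)..t, kernelI τ v := by
    ext t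
    rw [← tail_sub_tail (by linarith) hτ1]
    ring
  rw [h]
  exact (intervalIntegral.integral_hasDerivAt_right (hk.intervalIntegrable _ _)
    hk.stronglyMeasurable.stronglyMeasurableAtFilter hk.continuousAt).const_sub _

/-! ### From the tail ratio to the argmax -/

/-- Only the largest threshold matters, and without atoms weak and strict inequalities have equal
probability. With no rival both events are the whole line, whence the assumption 1 ≤ C. -/
lemma measure_forall_le_le_mul {μ : Measure ℝ} [IsProbabilityMeasure μ] [NullSingletonClass μ] {C : ENNReal}
    (hC : 1 ≤ C) (hμ : ∀ m, μ (Set.Ioi m) ≤ C * μ (Set.Ioi (m + 2))) {ι : Type*} [Finite ι]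
    (c : ι → ℝ) : μ {x | ∀ j, c j ≤ x} ≤ C * μ {x | ∀ j, c j + 2 < x} := by
  cases isEmpty_or_nonempty ι
  · simpa
  obtain ⟨j₀, hj₀⟩ := Finite.exists_max c
  have h1 : {x | ∀ j, c j ≤ x} = Set.Ici (c j₀) :=
    Set.ext fun x => ⟨fun h => h j₀, fun h j => (hj₀ j).trans h⟩
  have h2 : {x | ∀ j, c j + 2 < x} = Set.Ioi (c j₀ + 2) :=
    Set.ext fun x => ⟨fun h => h j₀, fun h j => lt_of_le_of_lt (by linarith [hj₀ j]) h⟩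
  rw [h1, h2, measure_congr Ioi_ae_eq_Ici.symm]
  exact hμ _

/-- If no noisy count moves by more than one, the probability that the label `k` wins changes by
a factor at most `C`, a bound on the likelihood ratio of a single noise for a shift of two. -/
lemma measure_sel_eq_le_mul {μ : Measure ℝ} [IsProbabilityMeasure μ] [NullSingletonClass μ] {C : ENNReal}
    (hC : 1 ≤ C) (hμ : ∀ m, μ (Set.Ioi m) ≤ C * μ (Set.Ioi (m + 2))) {K : ℕ}
    {sel : (Fin K → ℝ) → Fin K} (hsel : IsArgmaxRule sel) {b b' : Fin K → ℝ}
    (hb : ∀ j, |b j - b' j| ≤ 1) (k : Fin K) :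
    (Measure.pi fun _ : Fin K => μ) {z | sel (b + z) = k} ≤
      C * (Measure.pi fun _ : Fin K => μ) {z | sel (b' + z) = k} := by
  cases K with
  | zero => exact k.elim0
  | succ K =>
    set P := Measure.pi fun _ : Fin (K + 1) => μ
    -- The level that the noise of k must reach to match rival j, given the noises y of the rivals.
    set c : (Fin K → ℝ) → Fin K → ℝ := fun y j => b (k.succAbove j) + y j - b k
    have hmp := measurePreserving_piFinSuccAbove (fun _ : Fin (K + 1) => μ) k
    set A : Set (ℝ × (Fin K → ℝ)) := {p | ∀ j, c p.2 j ≤ p.1}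
    set B : Set (ℝ × (Fin K → ℝ)) := {p | ∀ j, c p.2 j + 2 < p.1}
    have hA : MeasurableSet A := by
      simp only [A, c, Set.ofPred_forall]
      exact MeasurableSet.iInter fun j => measurableSet_le (by fun_prop) (by fun_prop)
    have hB : MeasurableSet B := by
      simp only [B, c, Set.ofPred_forall]
      exact MeasurableSet.iInter fun j => measurableSet_lt (by fun_prop) (by fun_prop)
    have hAB : P (MeasurableEquiv.piFinSuccAbove (fun _ => ℝ) k ⁻¹' A) ≤
        C * P (MeasurableEquiv.piFinSuccAbove (fun _ => ℝ) k ⁻¹' B) := by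
      rw [hmp.measure_preimage hA.nullMeasurableSet, hmp.measure_preimage hB.nullMeasurableSet,
        Measure.prod_apply_symm hA, Measure.prod_apply_symm hB,
        ← lintegral_const_mul _ (measurable_measure_prodMk_right hB)]
      exact lintegral_mono fun y => measure_forall_le_le_mul hC hμ (c y)
    -- Whatever the tie-breaking, winning with counts b forces the weak inequalities of A, and the
    -- margin 2 in B forces a strict win with counts b'.
    refine (measure_mono ?_).trans (hAB.trans (mul_le_mul_right (measure_mono ?_) C))
    · intro z hz j
      have h := hsel.2 (b + z) (k.succAbove j)
      rw [show sel (b + z) = k from hz, Pi.add_apply, Pi.add_apply] at h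
      simp only [c, MeasurableEquiv.piFinSuccAbove_apply, Fin.insertNthEquiv_symm_apply,
        Fin.removeNth]
      linarith
    · intro z hz
      by_contra hne
      obtain ⟨j, hj⟩ := Fin.exists_succAbove_eq (show sel (b' + z) ≠ k from hne)
      have h := hsel.2 (b' + z) k
      have h2 := hz j
      simp only [c, MeasurableEquiv.piFinSuccAbove_apply, Fin.insertNthEquiv_symm_apply,
        Fin.removeNth] at h2
      rw [← hj, Pi.add_apply, Pi.add_apply] at h
      have h3 := abs_le.1 (hb k)
      have h4 := abs_le.1 (hb (k.succAbove j))
      linarith [h3.1, h3.2, h4.1, h4.2]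

lemma measure_sel_mem_le_mul {μ : Measure ℝ} [IsProbabilityMeasure μ] [NullSingletonClass μ] {C : ENNReal}
    (hC : 1 ≤ C) (hμ : ∀ m, μ (Set.Ioi m) ≤ C * μ (Set.Ioi (m + 2))) {K : ℕ}
    {sel : (Fin K → ℝ) → Fin K} (hsel : IsArgmaxRule sel) {b b' : Fin K → ℝ}
    (hb : ∀ j, |b j - b' j| ≤ 1) (T : Set (Fin K)) :
    (Measure.pi fun _ : Fin K => μ) {z | sel (b + z) ∈ T} ≤
      C * (Measure.pi fun _ : Fin K => μ) {z | sel (b' + z) ∈ T} := by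
  classical
  set P := Measure.pi fun _ : Fin K => μ
  have hm : ∀ a : Fin K → ℝ, Measurable fun z => sel (a + z) := fun a =>
    hsel.1.comp (by fun_prop)
  have h : ∀ a : Fin K → ℝ, P {z | sel (a + z) ∈ T} =
      ∑ k ∈ T.toFinite.toFinset, P {z | sel (a + z) = k} := by
    intro a
    have h1 := sum_measure_singleton (μ := P.map fun z => sel (a + z)) (s := T.toFinite.toFinset)
    rw [Set.Finite.coe_toFinset, Measure.map_apply (hm a) (Set.toFinite T).measurableSet] at h1
    simp_rw [Measure.map_apply (hm a) (measurableSet_singleton _)] at h1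
    exact h1.symm
  rw [h, h, Finset.mul_sum]
  exact Finset.sum_le_sum fun k _ => measure_sel_eq_le_mul hC hμ hsel hb k

/-! ### Votes, known noise and the law of the view -/

/-- The number of votes for each class. -/
def voteCount {n K : ℕ} {X : Type*} (f : Fin n → X → Fin K) (x : X) (k : Fin K) : ℝ :=
  ∑ i, if f i x = k then 1 else 0

lemma abs_voteCount_sub_le {n K : ℕ} {X : Type*} {f f' : Fin n → X → Fin K}
    (h : Adjacent f f') (x : X) (k : Fin K) : |voteCount f x k - voteCount f' x k| ≤ 1 := by
  obtain ⟨i₀, -, hi₀⟩ := h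
  rw [voteCount, voteCount, ← Finset.sum_sub_distrib, Finset.sum_eq_single i₀
    (fun i _ hi => by rw [hi₀ i hi, sub_self]) (fun h => absurd (Finset.mem_univ _) h)]
  split_ifs <;> norm_num

lemma noisyCount_joinNoise {n K : ℕ} {X : Type*} (f : Fin n → X → Fin K) (x : X)
    (H : Finset (Fin n)) (w : {i // i ∈ H} → Fin K → ℝ) (c : {i // i ∉ H} → Fin K → ℝ) :
    noisyCount f x (joinNoise H w c) = voteCount f x + ∑ i, c i + ∑ i, w i := by
  ext k
  have h : ∑ i : {i // i ∈ H}, joinNoise H w c i k + ∑ i : {i // i ∉ H}, joinNoise H w c i k =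
      ∑ i, joinNoise H w c i k := by
    convert Fintype.sum_subtype_add_sum_subtype (fun i => i ∈ H) fun i => joinNoise H w c i k
  have h1 : ∀ i : {i // i ∈ H}, joinNoise H w c i k = w i k := fun i => by simp [joinNoise, i.2]
  have h2 : ∀ i : {i // i ∉ H}, joinNoise H w c i k = c i k := fun i => by simp [joinNoise, i.2]
  simp_rw [h1, h2] at h
  rw [noisyCount, Finset.sum_add_distrib, ← h, Pi.add_apply, Pi.add_apply, Finset.sum_apply,
    Finset.sum_apply, voteCount]
  ring

lemma measurable_view {n K : ℕ} {X : Type*} (f : Fin n → X → Fin K) (x : X)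
    (H : Finset (Fin n)) {sel : (Fin K → ℝ) → Fin K} (hsel : IsArgmaxRule sel) :
    Measurable fun p : ({i // i ∉ H} → Fin K → ℝ) × ({i // i ∈ H} → Fin K → ℝ) =>
      (p.1, sel (noisyCount f x (joinNoise H p.2 p.1))) := by
  simp_rw [noisyCount_joinNoise]
  exact measurable_fst.prodMk (hsel.1.comp (by fun_prop))

lemma map_sum_hiddenNoise {n : ℕ} (K : ℕ) {γ τ : ℝ} (hγ : 0 < γ) {H : Finset (Fin n)}
    (hτ : τ = (H.card : ℝ) / n) (hτ0 : 0 < τ) :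
    (hiddenNoise K H γ).map (fun w => ∑ i, w i) =
      Measure.pi fun _ : Fin K => gammaDiffLaw τ γ := by
  have hn : n ≠ 0 := by
    rintro rfl
    simp [hτ] at hτ0
  have hH : H.Nonempty := by
    rw [Finset.nonempty_iff_ne_empty]
    rintro rfl
    simp [hτ] at hτ0
  have : Nonempty {i // i ∈ H} := hH.to_subtype
  have h := map_sum_pi_pi_gammaDiffLaw (ι := {i // i ∈ H}) (κ := Fin K) (a := 1 / n)
    (by positivity) hγ
  rw [Fintype.card_coe, mul_one_div, ← hτ] at h
  exact h

lemma isProbabilityMeasure_hiddenNoise {n : ℕ} (K : ℕ) {γ : ℝ} (hγ : 0 < γ) (H : Finset (Fin n))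
    (hn : n ≠ 0) : IsProbabilityMeasure (hiddenNoise K H γ) := by
  have : IsProbabilityMeasure (gammaDiff n γ) :=
    isProbabilityMeasure_gammaDiffLaw (a := 1 / n) (by positivity) hγ
  unfold hiddenNoise
  infer_instance

/-- Fubini over the known noise c: each slice sees only the summed hidden noise, with the counts
shifted by the sum of c. -/
lemma viewLaw_apply {n K : ℕ} {X : Type*} {γ τ : ℝ} (hγ : 0 < γ) {H : Finset (Fin n)}
    (hτ : τ = (H.card : ℝ) / n) (hτ0 : 0 < τ) {sel : (Fin K → ℝ) → Fin K}
    (hsel : IsArgmaxRule sel) (ν : Measure ({i // i ∉ H} → Fin K → ℝ)) [IsProbabilityMeasure ν]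
    (x : X) (f : Fin n → X → Fin K) {S : Set (({i // i ∉ H} → Fin K → ℝ) × Fin K)}
    (hS : MeasurableSet S) :
    viewLaw γ H sel ν x f S = ∫⁻ c, (Measure.pi fun _ : Fin K => gammaDiffLaw τ γ)
      {z | sel (voteCount f x + ∑ i, c i + z) ∈ Prod.mk c ⁻¹' S} ∂ν := by
  have hn : n ≠ 0 := by
    rintro rfl
    simp [hτ] at hτ0
  have := isProbabilityMeasure_hiddenNoise K hγ H hn
  have hmeas := measurable_view f x H hsel
  rw [viewLaw, Measure.map_apply hmeas hS, Measure.prod_apply (hmeas hS)]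
  refine lintegral_congr fun c => ?_
  have hz : MeasurableSet {z | sel (voteCount f x + ∑ i, c i + z) ∈ Prod.mk c ⁻¹' S} :=
    (hsel.1.comp (by fun_prop)) (measurable_prodMk_left hS)
  rw [← map_sum_hiddenNoise K hγ hτ hτ0, Measure.map_apply (by fun_prop) hz]
  congr 1
  ext w
  simp [noisyCount_joinNoise]

/-- Report-noisy-max with hidden Gamma difference noise is private, as soon as the likelihood ratio
of the exceedances of `s` and `s + 2` by the total hidden noise is bounded. -/
lemma isDP_viewLaw {n K : ℕ} {X : Type*} {γ τ ε : ℝ} (hγ : 0 < γ) {H : Finset (Fin n)}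
    (hτ : τ = (H.card : ℝ) / n) (hτ0 : 0 < τ) {sel : (Fin K → ℝ) → Fin K}
    (hsel : IsArgmaxRule sel) (ν : Measure ({i // i ∉ H} → Fin K → ℝ)) [IsProbabilityMeasure ν]
    (x : X) (hε : 0 ≤ ε)
    (h : ∀ m, (gammaDiffLaw τ γ).real (Set.Ioi m) ≤
      Real.exp ε * (gammaDiffLaw τ γ).real (Set.Ioi (m + 2))) :
    IsDP Adjacent (viewLaw γ H sel ν x) ε 0 := by
  have hn : n ≠ 0 := by
    rintro rfl
    simp [hτ] at hτ0
  have := isProbabilityMeasure_hiddenNoise K hγ H hn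
  have := isProbabilityMeasure_gammaDiffLaw hτ0 hγ
  have : NullSingletonClass (gammaDiffLaw τ γ) := by
    rw [gammaDiffLaw_eq_withDensity]
    infer_instance
  have hprob : ∀ f : Fin n → X → Fin K, IsProbabilityMeasure (viewLaw γ H sel ν x f) := fun f =>
    Measure.isProbabilityMeasure_map (measurable_view f x H hsel).aemeasurable
  refine ⟨hprob, fun f f' hff' S hS => ?_⟩
  have := hprob f
  have := hprob f'
  have hC : 1 ≤ ENNReal.ofReal (Real.exp ε) := by
    rw [ENNReal.one_le_ofReal]
    exact Real.one_le_exp hε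
  have hμ : ∀ m, gammaDiffLaw τ γ (Set.Ioi m) ≤
      ENNReal.ofReal (Real.exp ε) * gammaDiffLaw τ γ (Set.Ioi (m + 2)) := fun m => by
    rw [← ofReal_measureReal, ← ofReal_measureReal (s := Set.Ioi (m + 2)),
      ← ENNReal.ofReal_mul (Real.exp_pos _).le]
    exact ENNReal.ofReal_le_ofReal (h m)
  have key : viewLaw γ H sel ν x f S ≤
      ENNReal.ofReal (Real.exp ε) * viewLaw γ H sel ν x f' S := by
    rw [viewLaw_apply hγ hτ hτ0 hsel ν x f hS, viewLaw_apply hγ hτ hτ0 hsel ν x f' hS,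
      ← lintegral_const_mul' _ _ ENNReal.ofReal_ne_top]
    refine lintegral_mono fun c => measure_sel_mem_le_mul hC hμ hsel (fun j => ?_) _
    simpa using abs_voteCount_sub_le hff' x j
  have hreal := ENNReal.toReal_mono (by finiteness) key
  rw [ENNReal.toReal_mul, ENNReal.toReal_ofReal (Real.exp_pos _).le] at hreal
  rw [add_zero]
  exact hreal

/-! ### The explicit privacy parameters -/

lemma setIntegral_Ioi_eq_tail {τ s : ℝ} (hs : 0 ≤ s) :
    ∫ v in Set.Ioi s, Real.exp (-v) * funI τ v = tail τ s :=
  setIntegral_congr_fun measurableSet_Ioi fun v hv => by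
    simp only [abs_of_pos (hs.trans_lt (Set.mem_Ioi.1 hv))]

lemma integral_zero_eq_tail_sub_tail {τ γ : ℝ} (hτ0 : 0 < τ) (hτ1 : τ < 1) (hγ : 0 ≤ γ) :
    ∫ v in (0 : ℝ)..γ, Real.exp (-v) * funI τ v = tail τ 0 - tail τ γ := by
  rw [tail_sub_tail hτ0 hτ1]
  refine intervalIntegral.integral_congr fun v hv => ?_
  rw [Set.uIcc_of_le hγ] at hv
  simp only [kernelI, abs_of_nonneg hv.1]

lemma exp_epsGamma {γ τ : ℝ} (hτ0 : 0 < τ) (hτ1 : τ < 1) (hγ : 0 < γ) :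
    Real.exp (epsGamma γ τ) = 1 + 2 * ((tail τ 0 - tail τ γ) / tail τ (2 * γ)) := by
  have hT2 := tail_pos hτ0 hτ1 (2 * γ)
  have hJ : 0 ≤ tail τ 0 - tail τ γ := sub_nonneg.2 (tail_antitone hτ0 hτ1 hγ.le)
  rw [epsGamma, integral_zero_eq_tail_sub_tail hτ0 hτ1 hγ.le,
    setIntegral_Ioi_eq_tail (by positivity), Real.exp_log (by positivity)]

lemma gPrimeZero_eq {γ τ : ℝ} (hτ0 : 0 < τ) (hτ1 : τ < 1) (hγ : 0 < γ) :
    gPrimeZero γ τ = γ * ((tail τ 0 * kernelI τ (2 * γ) - kernelI τ 0 * tail τ (2 * γ)) /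
      tail τ (2 * γ) ^ 2) := by
  rw [gPrimeZero, setIntegral_Ioi_eq_tail (by positivity), ← tail_zero hτ0 hτ1, kernelI, kernelI,
    abs_of_pos (by positivity : 0 < 2 * γ)]
  simp [mul_assoc]

lemma funG_zero (γ τ : ℝ) : funG γ τ 0 = tail τ 0 / tail τ (2 * γ) := by
  rw [funG, mul_zero, zero_add, mul_comm γ]

lemma hasDerivAt_funG {γ τ : ℝ} (hτ : 1 / 2 < τ) (hτ1 : τ < 1) (hγ : 0 < γ) :
    HasDerivAt (funG γ τ) (gPrimeZero γ τ) 0 := by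
  have hτ0 : 0 < τ := by linarith
  have h1 : HasDerivAt (fun t : ℝ => γ * t) γ 0 := by
    simpa using (hasDerivAt_id (0 : ℝ)).const_mul γ
  have h2 : HasDerivAt (fun t : ℝ => γ * (t + 2)) γ 0 := by
    simpa using ((hasDerivAt_id (0 : ℝ)).add_const 2).const_mul γ
  have h3 := (hasDerivAt_tail hτ hτ1 (γ * 0)).comp 0 h1
  have h4 := (hasDerivAt_tail hτ hτ1 (γ * (0 + 2))).comp 0 h2
  rw [gPrimeZero_eq hτ0 hτ1 hγ]
  refine (h3.div h4 (tail_pos hτ0 hτ1 _).ne').congr_deriv ?_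
  simp only [Function.comp, mul_zero, zero_add, mul_comm γ 2]
  ring

/-- At s = 0 the bound compares T(0) with the smaller T(2b), so its constant is at least 1, as the
argmax comparison requires. -/
lemma nonneg_of_tail_le_exp_mul_tail {τ b ε : ℝ} (hτ0 : 0 < τ) (hτ1 : τ < 1) (hb : 0 < b)
    (h : ∀ s, tail τ s ≤ Real.exp ε * tail τ (s + 2 * b)) : 0 ≤ ε := by
  have hT := tail_pos hτ0 hτ1 (0 + 2 * b)
  refine Real.one_le_exp_iff.1 ?_
  refine le_of_mul_le_mul_right ?_ hT
  rw [one_mul]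
  exact (tail_antitone hτ0 hτ1 (by linarith)).trans (h 0)

lemma isDP_viewLaw_of_tail_le {n K : ℕ} {X : Type*} {γ τ ε : ℝ} (hγ : 0 < γ)
    {H : Finset (Fin n)} (hτ : τ = (H.card : ℝ) / n) (hτ0 : 0 < τ) (hτ1 : τ < 1)
    {sel : (Fin K → ℝ) → Fin K} (hsel : IsArgmaxRule sel)
    (ν : Measure ({i // i ∉ H} → Fin K → ℝ)) [IsProbabilityMeasure ν] (x : X)
    (h : ∀ s, tail τ s ≤ Real.exp ε * tail τ (s + 2 * γ)) :
    IsDP Adjacent (viewLaw γ H sel ν x) ε 0 := by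
  refine isDP_viewLaw hγ hτ hτ0 hsel ν x (nonneg_of_tail_le_exp_mul_tail hτ0 hτ1 hγ h) fun m => ?_
  have hΓ := Real.Gamma_pos_of_pos hτ0
  rw [gammaDiffLaw_real_Ioi hτ0 hτ1 hγ, gammaDiffLaw_real_Ioi hτ0 hτ1 hγ, ← mul_div_assoc,
    show γ * (m + 2) = γ * m + 2 * γ by ring]
  exact div_le_div_of_nonneg_right (h _) (by positivity)

end

end NoisyVote

theorem theorem2 {X : Type*} (n K : ℕ) (γ τ : ℝ) (hγ : 0 < γ)
    -- the teachers whose noise is unknown to the entity, and their proportion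
    (H : Finset (Fin n)) (hτ : τ = (H.card : ℝ) / n) (hτ0 : 0 < τ) (hτ1 : τ < 1)
    -- an arbitrary tie-breaking policy
    (sel : (Fin K → ℝ) → Fin K) (hsel : NoisyVote.IsArgmaxRule sel)
    -- an arbitrary law for the noise known to the entity
    (ν : Measure ({i // i ∉ H} → Fin K → ℝ)) [IsProbabilityMeasure ν] :
    -- the integrals converge
    ((∀ v : ℝ, 0 < v → IntegrableOn (NoisyVote.integrandI τ v) (Set.Ioi 0)) ∧
      IntegrableOn (fun v => Real.exp (-v) * NoisyVote.funI τ v) (Set.Ioi 0) ∧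
      0 < ∫ v in Set.Ioi (2 * γ), Real.exp (-v) * NoisyVote.funI τ v) ∧
    -- privacy for every query
    (∀ x : X, NoisyVote.IsDP NoisyVote.Adjacent (NoisyVote.viewLaw γ H sel ν x)
      (NoisyVote.epsGamma γ τ) 0) ∧
    (1 / 2 < τ →
      IntegrableOn (NoisyVote.integrandI τ 0) (Set.Ioi 0) ∧
      HasDerivAt (NoisyVote.funG γ τ) (NoisyVote.gPrimeZero γ τ) 0 ∧
      0 < NoisyVote.funG γ τ 0 - NoisyVote.gPrimeZero γ τ ∧
      ∀ x : X, NoisyVote.IsDP NoisyVote.Adjacent (NoisyVote.viewLaw γ H sel ν x)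
        (min (NoisyVote.epsGamma γ τ)
          (Real.log (NoisyVote.funG γ τ 0 - NoisyVote.gPrimeZero γ τ))) 0) := by
  have hε : ∀ s, NoisyVote.tail τ s ≤
      Real.exp (NoisyVote.epsGamma γ τ) * NoisyVote.tail τ (s + 2 * γ) := fun s => by
    rw [NoisyVote.exp_epsGamma hτ0 hτ1 hγ]
    exact NoisyVote.tail_le_mul_tail hτ0 hτ1 hγ s
  refine ⟨⟨fun v hv => NoisyVote.integrableOn_integrandI hτ0 hτ1 hv, ?_, ?_⟩, fun x =>
    NoisyVote.isDP_viewLaw_of_tail_le hγ hτ hτ0 hτ1 hsel ν x hε, fun hτ2 => ?_⟩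
  · refine (NoisyVote.integrable_kernelI hτ0 hτ1).integrableOn.congr_fun (fun v hv => ?_)
      measurableSet_Ioi
    rw [NoisyVote.kernelI, abs_of_pos (Set.mem_Ioi.1 hv)]
  · rw [NoisyVote.setIntegral_Ioi_eq_tail (by positivity)]
    exact NoisyVote.tail_pos hτ0 hτ1 _
  · have hC : ∀ s, NoisyVote.tail τ s ≤ (NoisyVote.funG γ τ 0 - NoisyVote.gPrimeZero γ τ) *
        NoisyVote.tail τ (s + 2 * γ) := fun s => by
      rw [NoisyVote.funG_zero, NoisyVote.gPrimeZero_eq hτ0 hτ1 hγ]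
      exact NoisyVote.tail_le_tangent_mul_tail hτ2 hτ1 hγ s
    -- At s = 0 the tangent bound has a positive left side, so its constant is positive and its
    -- logarithm is meaningful.
    have hpos : 0 < NoisyVote.funG γ τ 0 - NoisyVote.gPrimeZero γ τ :=
      pos_of_mul_pos_left ((NoisyVote.tail_pos hτ0 hτ1 0).trans_le (hC 0))
        (NoisyVote.tail_pos hτ0 hτ1 _).le
    refine ⟨NoisyVote.integrableOn_integrandI_zero hτ2, NoisyVote.hasDerivAt_funG hτ2 hτ1 hγ, hpos,
      fun x => ?_⟩
    rcases min_choice (NoisyVote.epsGamma γ τ)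
      (Real.log (NoisyVote.funG γ τ 0 - NoisyVote.gPrimeZero γ τ)) with hmin | hmin
    · rw [hmin]
      exact NoisyVote.isDP_viewLaw_of_tail_le hγ hτ hτ0 hτ1 hsel ν x hε
    · rw [hmin]
      refine NoisyVote.isDP_viewLaw_of_tail_le hγ hτ hτ0 hτ1 hsel ν x fun s => ?_
      rw [Real.exp_log hpos]
      exact hC s
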